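/- Let $\mathcal H$ be a separable complex Hilbert space, and let $\mathcal P_{\infty,\infty}$ be the set of orthogonal projections $P=P^2=P^*\in\mathcal B(\mathcal H)$ whose range $R(P)$ and nullspace $N(P)$ are both infinite-dimensional. Two closed subspaces $\mathcal S,\mathcal T\subset\mathcal H$ have a common complement if there is a closed subspace $\mathcal Z\subset\mathcal H$ with $\mathcal S\dot+\mathcal Z=\mathcal T\dot+\mathcal Z=\mathcal H$, where $\dot+$ denotes the direct (not necessarily orthogonal) sum. Let $$\boldsymbol\Delta_\infty=\{(P,Q)\in\mathcal P_{\infty,\infty}\times\mathcal P_{\infty,\infty}: R(P)\text{ and }R(Q)\text{ have a common complement}\}.$$ Then $\boldsymbol\Delta_\infty$ is dense in $\mathcal P_{\infty,\infty}\times\mathcal P_{\infty,\infty}$ with respect to the topology induced by the operator norm. -/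

import Mathlib

/-- Two subspaces `S`, `T` of `H` have a common complement: there is a closed subspace `Z` with
`S ∔ Z = T ∔ Z = H` (direct, not necessarily orthogonal, sums). -/
def HaveCommonComplement {H : Type*} [NormedAddCommGroup H] [InnerProductSpace ℂ H]
    (S T : Submodule ℂ H) : Prop :=
  ∃ Z : Submodule ℂ H, IsClosed (Z : Set H) ∧ IsCompl S Z ∧ IsCompl T Z

/-- `Δ`: the pairs of orthogonal projections whose ranges have a common complement. -/
def commonComplementPairs (H : Type*) [NormedAddCommGroup H] [InnerProductSpace ℂ H]
    [CompleteSpace H] : Set ((H →L[ℂ] H) × (H →L[ℂ] H)) :=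
  {x | IsStarProjection x.1 ∧ IsStarProjection x.2 ∧
    HaveCommonComplement (LinearMap.range (x.1 : H →ₗ[ℂ] H)) (LinearMap.range (x.2 : H →ₗ[ℂ] H))}

/-- `P_{∞,∞}`: the orthogonal projections of infinite rank and infinite corank. -/
def infProjections (H : Type*) [NormedAddCommGroup H] [InnerProductSpace ℂ H]
    [CompleteSpace H] : Set (H →L[ℂ] H) :=
  {P | IsStarProjection P ∧ ¬ FiniteDimensional ℂ (LinearMap.range (P : H →ₗ[ℂ] H)) ∧
    ¬ FiniteDimensional ℂ (LinearMap.ker (P : H →ₗ[ℂ] H))}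

/-- `Δ_∞`: the pairs in `Δ` both of whose members lie in `P_{∞,∞}`. -/
def commonComplementPairsInf (H : Type*) [NormedAddCommGroup H] [InnerProductSpace ℂ H]
    [CompleteSpace H] : Set ((H →L[ℂ] H) × (H →L[ℂ] H)) :=
  commonComplementPairs H ∩ infProjections H ×ˢ infProjections H

/-! Two facts combine. If `Q * P * (1 - Q)` is not compact, the ranges of `P` and `Q` have a common
complement: non-compactness gives a copy of ℓ² in `ker Q` on which `Q * P` is bounded below, which
leaves enough room to build a projection onto `range P` that maps `range Q` bijectively onto `range
P` (`haveCommonComplement_of_not_isCompactOperator`).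

Non-compactness is reached by moving only `Q`, along unitary conjugations by `exp (t • Y)`. If the
operator stayed compact for all small `t`, so would its derivative at `0`. Were this so for every
skew-adjoint `Y`, primeness of the Calkin algebra (`exists_not_isCompactOperator_mul_mul`) would
make one of `P`, `1 - P`, `Q`, `1 - Q` compact, against infinite rank and corank. -/

open scoped lp InnerProductSpace


/-! ### Non-compact operators and copies of ℓ². -/

section HilbertSpace

variable {E F : Type*} [NormedAddCommGroup E] [InnerProductSpace ℂ E]
  [NormedAddCommGroup F] [InnerProductSpace ℂ F]

theorem infinite_of_hilbertBasis {ι : Type*} (b : HilbertBasis ι ℂ E)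
    (hE : ¬ FiniteDimensional ℂ E) : Infinite ι := by
  by_contra h
  have : Finite ι := not_infinite_iff_finite.mp h
  have := Fintype.ofFinite ι
  exact hE b.toOrthonormalBasis.toBasis.finiteDimensional_of_finite

theorem not_finiteDimensional_ellTwo : ¬ FiniteDimensional ℂ ℓ²(ℕ, ℂ) := by
  intro h
  have b : HilbertBasis ℕ ℂ ℓ²(ℕ, ℂ) := ⟨LinearIsometryEquiv.refl ℂ _⟩
  have := b.orthonormal.linearIndependent.finite
  exact not_finite ℕ

theorem Orthonormal.countable_of_separableSpace [TopologicalSpace.SeparableSpace E] {ι : Type*}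
    {v : ι → E} (hv : Orthonormal ℂ v) : Countable ι := by
  refine Pairwise.countable_of_isOpen_disjoint (s := fun i => Metric.ball (v i) (1 / 2)) ?_
    (fun _ => Metric.isOpen_ball) (fun i => ⟨v i, Metric.mem_ball_self (by norm_num)⟩)
  intro i j hij
  refine Metric.ball_disjoint_ball ?_
  have h : ‖v i - v j‖ ^ 2 = 2 := by
    rw [@norm_sub_sq ℂ, hv.1 i, hv.1 j, hv.2 hij]
    norm_num
  rw [dist_eq_norm]
  nlinarith [norm_nonneg (v i - v j)]

variable [CompleteSpace F]

/-- Otherwise `A` is a norm limit of finite-rank operators `A ∘L V.starProjection`. -/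
theorem exists_orthogonal_lt_norm_of_not_isCompactOperator {A : E →L[ℂ] F}
    (hA : ¬ IsCompactOperator A) : ∃ δ > 0, ∀ V : Submodule ℂ E, FiniteDimensional ℂ V →
      ∃ x ∈ Vᗮ, δ * ‖x‖ < ‖A x‖ := by
  by_contra! h
  refine hA (isClosed_setOfPred_isCompactOperator.closure_subset (Metric.mem_closure_iff.2 ?_))
  intro ε hε
  obtain ⟨V, hV, hAV⟩ := h (ε / 2) (by positivity)
  refine ⟨A ∘L V.starProjection, ?_, ?_⟩
  · have h1 : IsCompactOperator V.orthogonalProjectionOnto :=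
      isCompactOperator_of_locallyCompactSpace_dom _
    exact h1.clm_comp (A ∘L V.subtypeL)
  · rw [dist_eq_norm]
    refine lt_of_le_of_lt (ContinuousLinearMap.opNorm_le_bound _ (half_pos hε).le fun x => ?_)
      (half_lt_self hε)
    have h2 := hAV _ (Submodule.sub_starProjection_mem_orthogonal (K := V) x)
    rw [map_sub] at h2
    refine h2.trans ?_
    gcongr
    have h3 := V.norm_sq_eq_add_norm_sq_starProjection x
    rw [Submodule.starProjection_orthogonal_val] at h3
    exact le_of_sq_le_sq (by nlinarith [sq_nonneg ‖V.starProjection x‖]) (norm_nonneg x)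

variable [CompleteSpace E]

/-- An infinite-dimensional separable Hilbert space is isometrically isomorphic to `ℓ²(ℕ)`. -/
theorem nonempty_linearIsometryEquiv_ellTwo [TopologicalSpace.SeparableSpace E]
    (hE : ¬ FiniteDimensional ℂ E) : Nonempty (ℓ²(ℕ, ℂ) ≃ₗᵢ[ℂ] E) := by
  obtain ⟨w, b, -⟩ := exists_hilbertBasis ℂ E
  have : Infinite w := infinite_of_hilbertBasis b hE
  have : Countable w := b.orthonormal.countable_of_separableSpace
  obtain ⟨e⟩ := nonempty_equiv_of_countable (α := ℕ) (β := w)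
  have hv : Orthonormal ℂ (b ∘ e) := b.orthonormal.comp e e.injective
  have hs : ⊤ ≤ (Submodule.span ℂ (Set.range (b ∘ e))).topologicalClosure := by
    rw [e.surjective.range_comp, b.dense_span]
  exact ⟨(HilbertBasis.mk hv hs).repr.symm⟩

theorem exists_linearIsometry_infinite_orthogonal [TopologicalSpace.SeparableSpace F]
    (hE : ¬ FiniteDimensional ℂ E) :
    ∃ W : F →ₗᵢ[ℂ] E, ¬ FiniteDimensional ℂ (LinearMap.range W.toLinearMap)ᗮ := by
  obtain ⟨w, b, -⟩ := exists_hilbertBasis ℂ E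
  have : Infinite w := infinite_of_hilbertBasis b hE
  obtain ⟨u, c, -⟩ := exists_hilbertBasis ℂ F
  have : Countable u := c.orthonormal.countable_of_separableSpace
  obtain ⟨g, hg⟩ := Countable.exists_injective_nat u
  have hv : Orthonormal ℂ fun n : ℕ => b (Infinite.natEmbedding w n) :=
    b.orthonormal.comp _ (Infinite.natEmbedding w).injective
  -- Even-indexed vectors receive `F`; odd-indexed ones stay orthogonal to the image.
  have hW : Orthonormal ℂ fun i : u => b (Infinite.natEmbedding w (2 * g i)) :=
    hv.comp (fun i : u => 2 * g i) fun i j h => hg (by simpa using h)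
  have hR : Orthonormal ℂ fun n : ℕ => b (Infinite.natEmbedding w (2 * n + 1)) :=
    hv.comp (fun n : ℕ => 2 * n + 1) fun i j h => by simpa using h
  refine ⟨hW.orthogonalFamily.linearIsometry.comp c.repr.toLinearIsometry, fun hfin => ?_⟩
  have hmem : ∀ n : ℕ, b (Infinite.natEmbedding w (2 * n + 1)) ∈
      (LinearMap.range (hW.orthogonalFamily.linearIsometry.comp
        c.repr.toLinearIsometry).toLinearMap)ᗮ := by
    intro n
    rw [Submodule.mem_orthogonal']
    rintro _ ⟨x, rfl⟩
    have hs := (hW.orthogonalFamily.hasSum_linearIsometry (c.repr x)).mapL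
      (innerSL ℂ (b (Infinite.natEmbedding w (2 * n + 1))))
    refine hs.unique ?_
    convert hasSum_zero with i
    have h0 := hv.2 (i := 2 * n + 1) (j := 2 * g i) (by omega)
    simp only [LinearIsometry.toSpanSingleton_apply, innerSL_apply_apply, inner_smul_right, h0,
      mul_zero]
  have hR' : LinearIndependent ℂ fun n : ℕ =>
      (⟨_, hmem n⟩ : (LinearMap.range (hW.orthogonalFamily.linearIsometry.comp
        c.repr.toLinearIsometry).toLinearMap)ᗮ) :=
    LinearIndependent.of_comp (Submodule.subtype _) hR.linearIndependent
  have := hR'.finite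
  exact not_finite ℕ

/-- A bounded operator between Hilbert spaces that is bounded below has a bounded left inverse. -/
theorem exists_leftInverse_of_le_norm {A : E →L[ℂ] F} {c : ℝ} (hc : 0 < c)
    (hA : ∀ x, c * ‖x‖ ≤ ‖A x‖) : ∃ L : F →L[ℂ] E, L ∘L A = .id ℂ E := by
  have hu : IsUnit (A.adjoint ∘L A) := by
    refine ContinuousLinearMap.isUnit_of_forall_le_norm_inner_map _
      (c := ⟨c ^ 2, sq_nonneg c⟩) (by exact_mod_cast pow_pos hc 2) fun x => ?_
    rw [ContinuousLinearMap.comp_apply, ContinuousLinearMap.adjoint_inner_left,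
      inner_self_eq_norm_sq_to_K, norm_pow]
    simp only [Complex.coe_algebraMap, Complex.norm_real, norm_norm]
    change ‖x‖ ^ 2 * c ^ 2 ≤ ‖A x‖ ^ 2
    rw [← mul_pow, mul_comm]
    exact pow_le_pow_left₀ (by positivity) (hA x) 2
  obtain ⟨u, hu⟩ := hu
  refine ⟨(↑u⁻¹ : E →L[ℂ] E) ∘L A.adjoint, ?_⟩
  rw [ContinuousLinearMap.comp_assoc, ← hu]
  exact u.inv_mul

theorem not_isCompactOperator_of_le_norm (hE : ¬ FiniteDimensional ℂ E) {A : E →L[ℂ] F} {c : ℝ}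
    (hc : 0 < c) (hA : ∀ x, c * ‖x‖ ≤ ‖A x‖) : ¬ IsCompactOperator A := by
  intro h
  obtain ⟨L, hL⟩ := exists_leftInverse_of_le_norm hc hA
  refine hE (FiniteDimensional.of_isCompactOperator_id (𝕜 := ℂ) ?_)
  have := h.clm_comp L
  rwa [← ContinuousLinearMap.coe_comp, hL] at this

/-- A bounded operator that is not compact is bounded below on a copy of `ℓ²(ℕ)`. -/
theorem exists_linearIsometry_le_norm_of_not_isCompactOperator {A : E →L[ℂ] F}
    (hA : ¬ IsCompactOperator A) :
    ∃ J : ℓ²(ℕ, ℂ) →ₗᵢ[ℂ] E, ∃ c > 0, ∀ x, c * ‖x‖ ≤ ‖A (J x)‖ := by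
  classical
  obtain ⟨δ, hδ, h⟩ := exists_orthogonal_lt_norm_of_not_isCompactOperator hA
  -- Each new vector is orthogonal to the earlier `x` and to `A.adjoint (A x)`, so the images are
  -- orthogonal too.
  obtain ⟨v, hv, hvr⟩ := exists_seq_of_forall_finset_exists
    (fun x : E => ‖x‖ = 1 ∧ δ ≤ ‖A x‖) (fun x y => ⟪x, y⟫_ℂ = 0 ∧ ⟪A x, A y⟫_ℂ = 0) (by
      rintro s -
      obtain ⟨x, hx, hxA⟩ := h
        (Submodule.span ℂ ((s ∪ s.image (A.adjoint ∘L A) : Finset E) : Set E)) inferInstance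
      have hx0 : 0 < ‖x‖ := by
        rw [norm_pos_iff]
        rintro rfl
        simp at hxA
      rw [Submodule.mem_orthogonal] at hx
      refine ⟨(‖x‖⁻¹ : ℂ) • x, ⟨?_, ?_⟩, fun y hy => ⟨?_, ?_⟩⟩
      · rw [norm_smul]
        simp [hx0.ne']
      · rw [map_smul, norm_smul, norm_inv, Complex.norm_real, norm_norm, ← div_eq_inv_mul,
          le_div_iff₀ hx0]
        exact hxA.le
      · rw [inner_smul_right, hx y (Submodule.subset_span (by simp [hy])), mul_zero]
      · have hAy := hx _ (Submodule.subset_span (Finset.mem_coe.2 (Finset.mem_union_right _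
          (Finset.mem_image_of_mem (A.adjoint ∘L A) hy))))
        rw [ContinuousLinearMap.comp_apply, ContinuousLinearMap.adjoint_inner_left] at hAy
        rw [map_smul, inner_smul_right, hAy, mul_zero])
  have hsymm : ∀ m n, m ≠ n → ⟪v m, v n⟫_ℂ = 0 ∧ ⟪A (v m), A (v n)⟫_ℂ = 0 := by
    intro m n hmn
    rcases hmn.lt_or_gt with hlt | hlt
    · exact hvr m n hlt
    · exact ⟨inner_eq_zero_symm.1 (hvr n m hlt).1, inner_eq_zero_symm.1 (hvr n m hlt).2⟩
  have hvo : Orthonormal ℂ v := ⟨fun n => (hv n).1, fun m n hmn => (hsymm m n hmn).1⟩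
  have hpos : ∀ n, 0 < ‖A (v n)‖ := fun n => hδ.trans_le (hv n).2
  have hAo : Orthonormal ℂ fun n => (‖A (v n)‖⁻¹ : ℂ) • A (v n) := by
    refine ⟨fun n => ?_, fun m n hmn => ?_⟩
    · rw [norm_smul]
      simp [(hpos n).ne']
    · simp only [inner_smul_left, inner_smul_right, (hsymm m n hmn).2, mul_zero]
  refine ⟨hvo.orthogonalFamily.linearIsometry, δ, hδ, fun x => ?_⟩
  have hcoef : ∀ n, ‖⟪(‖A (v n)‖⁻¹ : ℂ) • A (v n), A (hvo.orthogonalFamily.linearIsometry x)⟫_ℂ‖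
      = ‖A (v n)‖ * ‖x n‖ := by
    intro n
    have hs := (hvo.orthogonalFamily.hasSum_linearIsometry x).mapL
      (innerSL ℂ ((‖A (v n)‖⁻¹ : ℂ) • A (v n)) ∘L A)
    have hs' := hs.unique (hasSum_single n ?_)
    · simp only [ContinuousLinearMap.comp_apply, innerSL_apply_apply,
        LinearIsometry.toSpanSingleton_apply, map_smul] at hs'
      rw [hs', inner_smul_left, inner_self_eq_norm_sq_to_K]
      simp only [norm_smul, norm_mul, map_inv₀, norm_inv, Complex.conj_ofReal, norm_pow,
        Complex.norm_real, Complex.coe_algebraMap, norm_norm]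
      field_simp [(hpos n).ne']
    · intro m hmn
      simp only [ContinuousLinearMap.comp_apply, innerSL_apply_apply,
        LinearIsometry.toSpanSingleton_apply, map_smul, inner_smul_left, (hsymm n m hmn.symm).2,
        mul_zero, smul_zero]
  refine le_of_sq_le_sq ?_ (norm_nonneg _)
  have hx : HasSum (fun n => ‖x n‖ ^ 2) (‖x‖ ^ 2) := by
    simpa using lp.hasSum_norm (p := 2) (by norm_num) x
  rw [mul_pow]
  -- Bessel's inequality for the normalised images.
  refine hasSum_le (fun n => ?_) (hx.mul_left (δ ^ 2))
    (hAo.inner_products_summable (A (hvo.orthogonalFamily.linearIsometry x))).hasSum |>.trans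
    (hAo.tsum_inner_products_le _)
  rw [hcoef, ← mul_pow]
  gcongr
  exact (hv n).2

/-- Where `A.adjoint` is bounded below by `c`, `A ∘L A.adjoint` is bounded below by `c ^ 2`, by
Cauchy–Schwarz. -/
theorem IsCompactOperator.adjoint {A : E →L[ℂ] F} (hA : IsCompactOperator A) :
    IsCompactOperator A.adjoint := by
  by_contra h
  obtain ⟨J, c, hc, hJ⟩ := exists_linearIsometry_le_norm_of_not_isCompactOperator h
  refine not_isCompactOperator_of_le_norm (A := A ∘L A.adjoint ∘L J.toContinuousLinearMap)
    (c := c ^ 2) not_finiteDimensional_ellTwo (pow_pos hc 2) (fun x => ?_)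
    (hA.comp_clm (A.adjoint ∘L J.toContinuousLinearMap))
  change c ^ 2 * ‖x‖ ≤ ‖A (A.adjoint (J x))‖
  rcases (norm_nonneg x).eq_or_lt with hx | hx
  · simp [← hx]
  refine le_of_mul_le_mul_right ?_ hx
  calc c ^ 2 * ‖x‖ * ‖x‖ = (c * ‖x‖) ^ 2 := by ring
    _ ≤ ‖A.adjoint (J x)‖ ^ 2 := pow_le_pow_left₀ (by positivity) (hJ x) 2
    _ = RCLike.re ⟪A (A.adjoint (J x)), J x⟫_ℂ := by
      rw [← ContinuousLinearMap.adjoint_inner_right, inner_self_eq_norm_sq]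
    _ ≤ ‖A (A.adjoint (J x))‖ * ‖J x‖ := re_inner_le_norm _ _
    _ = ‖A (A.adjoint (J x))‖ * ‖x‖ := by rw [J.norm_map]

/-- Primeness of the Calkin algebra: `Y` carries a copy of ℓ² preserved by `B` to one on which `A`
is bounded below. -/
theorem exists_not_isCompactOperator_mul_mul {A B : E →L[ℂ] E} (hA : ¬ IsCompactOperator A)
    (hB : ¬ IsCompactOperator B) : ∃ Y : E →L[ℂ] E, ¬ IsCompactOperator (A * Y * B : E →L[ℂ] E) := by
  obtain ⟨J, c, hc, hJ⟩ := exists_linearIsometry_le_norm_of_not_isCompactOperator hA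
  obtain ⟨J', c', hc', hJ'⟩ := exists_linearIsometry_le_norm_of_not_isCompactOperator hB
  obtain ⟨L, hL⟩ :=
    exists_leftInverse_of_le_norm (A := B ∘L J'.toContinuousLinearMap) hc' hJ'
  refine ⟨J.toContinuousLinearMap ∘L L, fun h => ?_⟩
  refine not_isCompactOperator_of_le_norm (A := A ∘L J.toContinuousLinearMap)
    not_finiteDimensional_ellTwo hc hJ ?_
  have h' := h.comp_clm J'.toContinuousLinearMap
  have hAJ : ⇑(A ∘L J.toContinuousLinearMap) =
      ⇑(A * (J.toContinuousLinearMap ∘L L) * B) ∘ ⇑J'.toContinuousLinearMap :=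
    funext fun x => congrArg (fun y => A (J y)) (DFunLike.congr_fun hL x).symm
  rwa [hAJ]

end HilbertSpace

/-! ### Construction of a common complement. -/

section CommonComplement

variable {H : Type*} [NormedAddCommGroup H] [InnerProductSpace ℂ H]

theorem isCompl_ker_of_injOn_of_surjOn {F : H →L[ℂ] H} {T : Submodule ℂ H}
    (hinj : ∀ x ∈ T, F x = 0 → x = 0) (hsurj : ∀ x, ∃ t ∈ T, F t = F x) :
    IsCompl T (LinearMap.ker (F : H →ₗ[ℂ] H)) := by
  refine ⟨Submodule.disjoint_def.2 fun x hx hx' => hinj x hx hx', ?_⟩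
  rw [Submodule.codisjoint_iff_exists_add_eq]
  intro x
  obtain ⟨t, ht, htx⟩ := hsurj x
  refine ⟨t, x - t, ht, ?_, by abel⟩
  simp [htx]

variable [CompleteSpace H]

theorem IsStarProjection.apply_apply {P : H →L[ℂ] H} (hP : IsStarProjection P) (x : H) :
    P (P x) = P x :=
  DFunLike.congr_fun hP.isIdempotentElem.eq x

theorem IsStarProjection.inner_apply_left {P : H →L[ℂ] H} (hP : IsStarProjection P) (x y : H) :
    ⟪P x, y⟫_ℂ = ⟪x, P y⟫_ℂ := by
  rw [← ContinuousLinearMap.adjoint_inner_right, hP.isSelfAdjoint.adjoint_eq]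

theorem IsStarProjection.norm_sq_apply_add {P : H →L[ℂ] H} (hP : IsStarProjection P) (x : H) :
    ‖P x‖ ^ 2 + ‖x - P x‖ ^ 2 = ‖x‖ ^ 2 := by
  have h : ⟪P x, x - P x⟫_ℂ = 0 := by
    rw [hP.inner_apply_left, map_sub, hP.apply_apply, sub_self, inner_zero_right]
  have := norm_add_sq_eq_norm_sq_add_norm_sq_of_inner_eq_zero _ _ h
  rw [add_sub_cancel] at this
  nlinarith

/-- If `Q P (1 - Q)` is not compact, the ranges of the orthogonal projections `P` and `Q` have a
common complement. -/
theorem haveCommonComplement_of_not_isCompactOperator [TopologicalSpace.SeparableSpace H]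
    {P Q : H →L[ℂ] H} (hP : IsStarProjection P) (hQ : IsStarProjection Q)
    (h : ¬ IsCompactOperator (Q * P * (1 - Q) : H →L[ℂ] H)) :
    HaveCommonComplement (LinearMap.range (P : H →ₗ[ℂ] H)) (LinearMap.range (Q : H →ₗ[ℂ] H)) := by
  have : SecondCountableTopology H := UniformSpace.secondCountable_of_separable H
  obtain ⟨J₀, c, hc, hJ₀⟩ := exists_linearIsometry_le_norm_of_not_isCompactOperator h
  -- `J` takes values in `ker Q`, and `Q ∘ P` is bounded below on its range.
  let J : ℓ²(ℕ, ℂ) →L[ℂ] H := (1 - Q) ∘L J₀.toContinuousLinearMap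
  have hQJ : ∀ x, Q (J x) = 0 := fun x => by
    change Q (J₀ x - Q (J₀ x)) = 0
    rw [map_sub, hQ.apply_apply, sub_self]
  have hJ : ∀ x, c * ‖x‖ ≤ ‖Q (P (J x))‖ := hJ₀
  let a : ℓ²(ℕ, ℂ) →L[ℂ] H := (1 - P) ∘L J
  have ha : ∀ x, a x = J x - P (J x) := fun x => rfl
  obtain ⟨L, hL⟩ := exists_leftInverse_of_le_norm (A := Q ∘L a) hc fun x => by
    rw [ContinuousLinearMap.comp_apply, ha, map_sub, hQJ, zero_sub, norm_neg]
    exact hJ x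
  -- A right inverse of `a.adjoint` with values in `range Q`, so `range Q` is the direct sum of
  -- `range τ` and `T₀` below.
  let τ : ℓ²(ℕ, ℂ) →L[ℂ] H := Q ∘L L.adjoint
  have hτ : ∀ e, a.adjoint (τ e) = e := fun e => by
    have h1 := congrArg ContinuousLinearMap.adjoint hL
    rw [ContinuousLinearMap.adjoint_comp, ContinuousLinearMap.adjoint_comp,
      hQ.isSelfAdjoint.adjoint_eq, ContinuousLinearMap.adjoint_id] at h1
    exact DFunLike.congr_fun h1 e
  have hQτ : ∀ e, Q (τ e) = τ e := fun e => hQ.apply_apply _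
  have haP : ∀ x, P x = x → a.adjoint x = 0 := fun x hx => by
    refine ext_inner_left ℂ fun e => ?_
    rw [ContinuousLinearMap.adjoint_inner_right, ha, inner_sub_left, hP.inner_apply_left, hx,
      sub_self, inner_zero_right]
  -- The range `K` of `P ∘ J` is orthogonal to `range Q ⊓ ker a.adjoint`.
  have hPJ : ∀ x, c * ‖x‖ ≤ ‖(P ∘L J) x‖ := fun x => by
    refine (hJ x).trans ?_
    have := hQ.norm_sq_apply_add (P (J x))
    change ‖Q (P (J x))‖ ≤ ‖P (J x)‖
    exact le_of_sq_le_sq (by nlinarith [sq_nonneg ‖P (J x) - Q (P (J x))‖]) (norm_nonneg _)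
  have hanti : AntilipschitzWith ⟨c⁻¹, by positivity⟩ (P ∘L J) :=
    (P ∘L J).antilipschitz_of_bound fun x => by
      change ‖x‖ ≤ c⁻¹ * _
      rw [← div_eq_inv_mul, le_div_iff₀ hc, mul_comm]
      exact hPJ x
  let K : Submodule ℂ H := LinearMap.range ((P ∘L J : ℓ²(ℕ, ℂ) →L[ℂ] H) : ℓ²(ℕ, ℂ) →ₗ[ℂ] H)
  have hKc : IsClosed (K : Set H) := hanti.isClosed_range (P ∘L J).uniformContinuous
  have : CompleteSpace K := hKc.completeSpace_coe
  have hKdim : ¬ FiniteDimensional ℂ K := fun hfin => by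
    refine not_finiteDimensional_ellTwo ?_
    have e := LinearEquiv.ofInjective ((P ∘L J : ℓ²(ℕ, ℂ) →L[ℂ] H) : ℓ²(ℕ, ℂ) →ₗ[ℂ] H)
      hanti.injective
    exact e.symm.finiteDimensional
  have hKP : ∀ k ∈ K, P k = k := by
    rintro _ ⟨e, rfl⟩
    exact hP.apply_apply _
  have hKorth : ∀ k ∈ K, ∀ x, Q x = x → a.adjoint x = 0 → ⟪k, x⟫_ℂ = 0 := by
    rintro _ ⟨e, rfl⟩ x hx hax
    have h1 : ⟪a e, x⟫_ℂ = 0 := by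
      rw [← ContinuousLinearMap.adjoint_inner_right, hax, inner_zero_right]
    have h2 : ⟪J e, x⟫_ℂ = 0 := by
      rw [← hx, ← hQ.inner_apply_left, hQJ, inner_zero_left]
    rw [ha, inner_sub_left, h2, zero_sub, neg_eq_zero] at h1
    exact h1
  obtain ⟨W, hW⟩ := exists_linearIsometry_infinite_orthogonal (F := H) hKdim
  -- `G` fixes `range P` and moves the part in `ker P` into `K`. On `T₀`, which is orthogonal to
  -- `K`, the two summands are orthogonal, hence `G` is isometric there.
  let G : H →L[ℂ] H := P + K.subtypeL ∘L W.toContinuousLinearMap ∘L (1 - P)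
  have hG : ∀ x, G x = P x + W (x - P x) := fun x => rfl
  have hPG : ∀ x, P (G x) = G x := fun x => by
    rw [hG, map_add, hP.apply_apply, hKP _ (W _).2]
  let T₀ : Submodule ℂ H :=
    LinearMap.ker ((1 - Q : H →L[ℂ] H) : H →ₗ[ℂ] H) ⊓ LinearMap.ker (a.adjoint : H →ₗ[ℂ] ℓ²(ℕ, ℂ))
  have hT₀ : ∀ x, x ∈ T₀ ↔ Q x = x ∧ a.adjoint x = 0 := fun x => by
    simp [T₀, sub_eq_zero, eq_comm (a := x)]
  have hT₀c : IsClosed (T₀ : Set H) := (1 - Q : H →L[ℂ] H).isClosed_ker.inter a.adjoint.isClosed_ker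
  have : CompleteSpace T₀ := hT₀c.completeSpace_coe
  have hGnorm : ∀ x ∈ T₀, ‖G x‖ = ‖x‖ := fun x hx => by
    rw [hT₀] at hx
    have h1 : ⟪P x, (W (x - P x) : H)⟫_ℂ = 0 := by
      rw [hP.inner_apply_left, hKP _ (W _).2, ← inner_conj_symm,
        hKorth _ (W _).2 x hx.1 hx.2, map_zero]
    have h2 := norm_add_sq_eq_norm_sq_add_norm_sq_of_inner_eq_zero _ _ h1
    have h3 := hP.norm_sq_apply_add x
    rw [← hG, ← Submodule.coe_norm, W.norm_map] at h2
    exact (sq_eq_sq₀ (norm_nonneg _) (norm_nonneg _)).1 (by nlinarith)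
  let R : Submodule ℂ H := LinearMap.range ((G ∘L T₀.subtypeL : T₀ →L[ℂ] H) : T₀ →ₗ[ℂ] H)
  have hRc : IsClosed (R : Set H) := by
    have hiso : Isometry (G ∘L T₀.subtypeL) :=
      AddMonoidHomClass.isometry_of_norm _ fun x => hGnorm x x.2
    exact hiso.antilipschitz.isClosed_range hiso.uniformContinuous
  have : CompleteSpace R := hRc.completeSpace_coe
  have hPR : ∀ r ∈ R, P r = r := by
    rintro _ ⟨x, rfl⟩
    exact hPG _
  let M : Submodule ℂ H := LinearMap.ker ((1 - P : H →L[ℂ] H) : H →ₗ[ℂ] H) ⊓ Rᗮ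
  have hM : ∀ x, x ∈ M ↔ P x = x ∧ x ∈ Rᗮ := fun x => by
    simp [M, sub_eq_zero, eq_comm (a := x)]
  have hMc : IsClosed (M : Set H) :=
    (1 - P : H →L[ℂ] H).isClosed_ker.inter R.isClosed_orthogonal
  have : CompleteSpace M := hMc.completeSpace_coe
  have hMdim : ¬ FiniteDimensional ℂ M := fun hfin => by
    -- The room that `W` leaves free in `K` is orthogonal to `R`.
    have hle : ((LinearMap.range W.toLinearMap)ᗮ).map K.subtype ≤ M := by
      rintro _ ⟨k, hk, rfl⟩
      refine (hM _).2 ⟨hKP _ k.2, ?_⟩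
      rw [Submodule.mem_orthogonal']
      rintro _ ⟨x, rfl⟩
      have hx := (hT₀ _).1 x.2
      change ⟪(k : H), P x + W (x - P x)⟫_ℂ = 0
      rw [inner_add_right, ← hP.inner_apply_left, hKP _ k.2, hKorth _ k.2 _ hx.1 hx.2, zero_add]
      exact (Submodule.mem_orthogonal' _ _).1 hk _ (LinearMap.mem_range_self _ _)
    have := Submodule.finiteDimensional_of_le hle
    exact hW (Submodule.equivMapOfInjective K.subtype K.injective_subtype
      (LinearMap.range W.toLinearMap)ᗮ).symm.finiteDimensional
  obtain ⟨U⟩ := nonempty_linearIsometryEquiv_ellTwo hMdim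
  -- The complement is the kernel of `F`, a bounded projection onto `range P`.
  let F : H →L[ℂ] H :=
    G + (M.subtypeL ∘L (U : ℓ²(ℕ, ℂ) →L[ℂ] M) - G ∘L τ) ∘L a.adjoint
  have hF : ∀ x, F x = G (x - τ (a.adjoint x)) + U (a.adjoint x) := fun x => by
    change G x + ((U (a.adjoint x) : H) - G (τ (a.adjoint x))) = _
    rw [map_sub]
    abel
  have hPF : ∀ x, P (F x) = F x := fun x => by
    rw [hF, map_add, hPG, ((hM _).1 (U _).2).1]
  have hFP : ∀ x, P x = x → F x = x := fun x hx => by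
    rw [hF, haP x hx, map_zero, map_zero, sub_zero, hG, hx, sub_self, map_zero]
    simp
  have hT₀mem : ∀ x, Q x = x → x - τ (a.adjoint x) ∈ T₀ := fun x hx =>
    (hT₀ _).2 ⟨by rw [map_sub, hx, hQτ], by rw [map_sub, hτ, sub_self]⟩
  refine ⟨LinearMap.ker (F : H →ₗ[ℂ] H), F.isClosed_ker, isCompl_ker_of_injOn_of_surjOn ?_ ?_,
    isCompl_ker_of_injOn_of_surjOn ?_ ?_⟩
  · rintro _ ⟨x, rfl⟩ hx
    exact (hFP (P x) (hP.apply_apply x)).symm.trans hx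
  · exact fun x => ⟨F x, ⟨F x, hPF x⟩, hFP _ (hPF x)⟩
  · rintro _ ⟨y, rfl⟩ hx
    change F (Q y) = 0 at hx
    change Q y = 0
    have hy := hQ.apply_apply y
    generalize Q y = x at hx hy
    rw [hF] at hx
    have hr : G (x - τ (a.adjoint x)) ∈ R := ⟨⟨_, hT₀mem x hy⟩, rfl⟩
    have horth := (Submodule.mem_orthogonal _ _).1 ((hM _).1 (U (a.adjoint x)).2).2 _ hr
    have hnorm := norm_add_sq_eq_norm_sq_add_norm_sq_of_inner_eq_zero _ _ horth
    rw [hx, norm_zero, ← Submodule.coe_norm, U.norm_map, hGnorm _ (hT₀mem x hy)] at hnorm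
    have h1 : a.adjoint x = 0 := norm_eq_zero.1 (by nlinarith [norm_nonneg (a.adjoint x)])
    have h2 : x - τ (a.adjoint x) = 0 :=
      norm_eq_zero.1 (by nlinarith [norm_nonneg (x - τ (a.adjoint x))])
    rwa [h1, map_zero, sub_zero] at h2
  -- Since `range P` is the orthogonal sum of `R` and `M`, `T₀` supplies the first component and `τ`
  -- the second.
  · intro x
    obtain ⟨r, hr, m, hm, hrm⟩ := R.exists_add_mem_mem_orthogonal (F x)
    have hPm : P m = m := by
      have := hPF x
      rw [hrm, map_add, hPR r hr] at this
      exact add_left_cancel this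
    obtain ⟨t, rfl⟩ := hr
    obtain ⟨e, he⟩ := U.surjective ⟨m, (hM m).2 ⟨hPm, hm⟩⟩
    have ht := (hT₀ _).1 t.2
    refine ⟨t + τ e, ⟨t + τ e, ?_⟩, ?_⟩
    · change Q (t + τ e) = _
      rw [map_add, ht.1, hQτ]
    · rw [hF, map_add, ht.2, hτ, zero_add, add_sub_cancel_right, he, hrm]
      rfl

end CommonComplement

/-! ### Perturbing `Q` by unitary conjugation. -/

section Perturbation

open Filter Topology

variable {H : Type*} [NormedAddCommGroup H] [InnerProductSpace ℂ H]

theorem mul_mem_compactOperator_left {A B : H →L[ℂ] H}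
    (hB : B ∈ compactOperator (RingHom.id ℂ) H H) : A * B ∈ compactOperator (RingHom.id ℂ) H H :=
  IsCompactOperator.clm_comp (f := B) hB A

theorem mul_mem_compactOperator_right {A B : H →L[ℂ] H}
    (hA : A ∈ compactOperator (RingHom.id ℂ) H H) : A * B ∈ compactOperator (RingHom.id ℂ) H H :=
  IsCompactOperator.comp_clm (f := A) hA B

variable [CompleteSpace H]

theorem star_mem_compactOperator {A : H →L[ℂ] H}
    (hA : A ∈ compactOperator (RingHom.id ℂ) H H) : star A ∈ compactOperator (RingHom.id ℂ) H H :=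
  IsCompactOperator.adjoint (A := A) hA

theorem finiteDimensional_of_isClosed_of_mem_compactOperator {A : H →L[ℂ] H}
    (hA : A ∈ compactOperator (RingHom.id ℂ) H H) {V : Submodule ℂ H} (hV : IsClosed (V : Set H))
    (hAV : ∀ x ∈ V, A x = x) : FiniteDimensional ℂ V := by
  have : CompleteSpace V := hV.completeSpace_coe
  by_contra h
  refine not_isCompactOperator_of_le_norm (A := A ∘L V.subtypeL) h one_pos (fun x => ?_)
    (IsCompactOperator.comp_clm (f := A) hA V.subtypeL)
  rw [ContinuousLinearMap.comp_apply, Submodule.subtypeL_apply, hAV x x.2, one_mul,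
    Submodule.coe_norm]

theorem notMem_compactOperator_of_mem_infProjections {P : H →L[ℂ] H} (hP : P ∈ infProjections H) :
    P ∉ compactOperator (RingHom.id ℂ) H H := fun h => by
  have hPx : ∀ x ∈ LinearMap.range (P : H →ₗ[ℂ] H), P x = x := by
    rintro _ ⟨x, rfl⟩
    exact hP.1.apply_apply x
  refine hP.2.1 (finiteDimensional_of_isClosed_of_mem_compactOperator h ?_ hPx)
  have : (LinearMap.range (P : H →ₗ[ℂ] H) : Set H) = {x | P x = x} :=
    Set.ext fun x => ⟨hPx x, fun hx => ⟨x, hx⟩⟩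
  rw [this]
  exact isClosed_eq P.continuous continuous_id

theorem one_sub_notMem_compactOperator_of_mem_infProjections {P : H →L[ℂ] H}
    (hP : P ∈ infProjections H) : 1 - P ∉ compactOperator (RingHom.id ℂ) H H := fun h =>
  hP.2.2 (finiteDimensional_of_isClosed_of_mem_compactOperator h P.isClosed_ker fun x hx => by
    have hx' : P x = 0 := hx
    simp [hx'])

theorem mem_compactOperator_or_of_forall_mul_mul {A B : H →L[ℂ] H}
    (h : ∀ Y : H →L[ℂ] H, A * Y * B ∈ compactOperator (RingHom.id ℂ) H H) :
    A ∈ compactOperator (RingHom.id ℂ) H H ∨ B ∈ compactOperator (RingHom.id ℂ) H H := by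
  by_contra! hAB
  obtain ⟨Y, hY⟩ := exists_not_isCompactOperator_mul_mul (A := A) (B := B) hAB.1 hAB.2
  exact hY (h Y)

/-- The derivative of `Q ↦ Q P (1 - Q)` along some infinitesimal unitary conjugation of `Q` is not
compact, unless `Q P (1 - Q)` is itself not compact. -/
theorem exists_skewAdjoint_notMem_compactOperator {P Q : H →L[ℂ] H} (hP : P ∈ infProjections H)
    (hQ : Q ∈ infProjections H) (hPQ : Q * P * (1 - Q) ∈ compactOperator (RingHom.id ℂ) H H) :
    ∃ Y ∈ skewAdjoint (H →L[ℂ] H), (Y * Q - Q * Y) * P * (1 - Q) - Q * P * (Y * Q - Q * Y) ∉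
      compactOperator (RingHom.id ℂ) H H := by
  by_contra! hskew
  set 𝒦 := compactOperator (RingHom.id ℂ) H H
  have hP2 : P * P = P := hP.1.isIdempotentElem.eq
  have hQ2 : Q * Q = Q := hQ.1.isIdempotentElem.eq
  -- The expression is complex linear in `Y`, and skew-adjoint operators span everything over ℂ.
  have hall : ∀ Y : H →L[ℂ] H,
      (Y * Q - Q * Y) * P * (1 - Q) - Q * P * (Y * Q - Q * Y) ∈ 𝒦 := by
    intro Y
    have hI : ∀ Z : H →L[ℂ] H, IsSelfAdjoint Z →
        (Z * Q - Q * Z) * P * (1 - Q) - Q * P * (Z * Q - Q * Z) ∈ 𝒦 := fun Z hZ => by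
      have h1 := 𝒦.smul_mem (-Complex.I) (hskew _ (hZ.smul_mem_skewAdjoint Complex.conj_I))
      convert h1 using 1
      simp only [smul_sub, smul_mul_assoc, mul_smul_comm, sub_mul, mul_sub, smul_smul]
      simp
    have h1 := hI _ (realPart Y).2
    have h2 := 𝒦.smul_mem Complex.I (hI _ (imaginaryPart Y).2)
    have h3 := 𝒦.add_mem h1 h2
    rw [← realPart_add_I_smul_imaginaryPart Y]
    convert h3 using 1
    simp only [smul_sub, smul_mul_assoc, mul_smul_comm, sub_mul, mul_sub, add_mul, mul_add]
    abel
  -- Multiplying by `1 - Q` on the right leaves this term modulo multiples of the compact `Q * P *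
  -- (1 - Q)`.
  have hcomm : ∀ Y : H →L[ℂ] H, Q * (P * Y - Y * P) * (1 - Q) ∈ 𝒦 := by
    intro Y
    have h1 := mul_mem_compactOperator_right (B := 1 - Q) (hall Y)
    have h2 := mul_mem_compactOperator_left (A := Y) hPQ
    have h3 := mul_mem_compactOperator_right (B := Y * (1 - Q)) hPQ
    have h4 := 𝒦.add_mem (𝒦.sub_mem h1 h2) h3
    convert h4 using 1
    have e : (1 - Q) * (1 - Q) = 1 - Q := hQ.1.one_sub.isIdempotentElem.eq
    have e' : Q * (1 - Q) = 0 := by rw [mul_sub, hQ2, mul_one, sub_self]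
    calc Q * (P * Y - Y * P) * (1 - Q)
        = Q * P * Y * (1 - Q) - Q * Y * P * (1 - Q) := by noncomm_ring
      _ = (Y * Q - Q * Y) * P * ((1 - Q) * (1 - Q)) - Q * P * (Y * (Q * (1 - Q)) - Q * Y * (1 - Q))
          - Y * (Q * P * (1 - Q)) + Q * P * (1 - Q) * (Y * (1 - Q)) := by
        rw [e, e']
        noncomm_ring
      _ = _ := by noncomm_ring
  have hA : ∀ Y : H →L[ℂ] H, Q * P * Y * ((1 - P) * (1 - Q)) ∈ 𝒦 := fun Y => by
    convert hcomm (Y * (1 - P)) using 1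
    have e : (1 - P) * P = 0 := by rw [sub_mul, hP2, one_mul, sub_self]
    calc Q * P * Y * ((1 - P) * (1 - Q))
        = Q * (P * (Y * (1 - P)) - Y * 0) * (1 - Q) := by noncomm_ring
      _ = _ := by rw [← e]; noncomm_ring
  have hB : ∀ Y : H →L[ℂ] H, Q * (1 - P) * Y * (P * (1 - Q)) ∈ 𝒦 := fun Y => by
    convert 𝒦.neg_mem (hcomm (Y * P)) using 1
    calc Q * (1 - P) * Y * (P * (1 - Q))
        = -(Q * (P * (Y * P) - Y * P) * (1 - Q)) := by noncomm_ring
      _ = -(Q * (P * (Y * P) - Y * (P * P)) * (1 - Q)) := by rw [hP2]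
      _ = _ := by noncomm_ring
  have sP : star P = P := hP.1.isSelfAdjoint
  have sQ : star Q = Q := hQ.1.isSelfAdjoint
  -- In the four cases the two compact products, up to adjoints, add to `Q`, `P`, `1 - P` and `1 -
  -- Q`.
  rcases mem_compactOperator_or_of_forall_mul_mul hA with h1 | h1 <;>
    rcases mem_compactOperator_or_of_forall_mul_mul hB with h2 | h2
  · refine notMem_compactOperator_of_mem_infProjections hQ ?_
    convert 𝒦.add_mem h1 h2 using 1
    noncomm_ring
  · refine notMem_compactOperator_of_mem_infProjections hP ?_
    convert 𝒦.add_mem (star_mem_compactOperator h1) h2 using 1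
    rw [star_mul, sP, sQ]
    noncomm_ring
  · refine one_sub_notMem_compactOperator_of_mem_infProjections hP ?_
    convert 𝒦.add_mem h1 (star_mem_compactOperator h2) using 1
    rw [star_mul, star_sub, star_one, sP, sQ]
    noncomm_ring
  · refine one_sub_notMem_compactOperator_of_mem_infProjections hQ ?_
    convert 𝒦.add_mem h1 h2 using 1
    noncomm_ring

theorem conj_mem_infProjections {Q u : H →L[ℂ] H} (hQ : Q ∈ infProjections H)
    (hu : u ∈ unitary (H →L[ℂ] H)) : u * Q * star u ∈ infProjections H := by
  have huu : ∀ x, star u (u x) = x := fun x => DFunLike.congr_fun (Unitary.mem_iff.1 hu).1 x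
  have hap : ∀ x, (u * Q * star u) (u x) = u (Q x) := fun x => congrArg (fun y => u (Q y)) (huu x)
  refine ⟨⟨?_, hQ.1.isSelfAdjoint.conjugate u⟩, fun h => hQ.2.1 ?_, fun h => hQ.2.2 ?_⟩
  · change u * Q * star u * (u * Q * star u) = u * Q * star u
    calc u * Q * star u * (u * Q * star u) = u * Q * (star u * u) * Q * star u := by noncomm_ring
      _ = u * (Q * Q) * star u := by rw [(Unitary.mem_iff.1 hu).1]; noncomm_ring
      _ = _ := by rw [hQ.1.isIdempotentElem.eq]
  · refine Submodule.finiteDimensional_of_le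
      (S₂ := (LinearMap.range (u * Q * star u : H →L[ℂ] H).toLinearMap).map
        (star u).toLinearMap) ?_
    rintro _ ⟨x, rfl⟩
    exact ⟨u (Q x), ⟨u x, hap x⟩, huu _⟩
  · refine Submodule.finiteDimensional_of_le
      (S₂ := (LinearMap.ker (u * Q * star u : H →L[ℂ] H).toLinearMap).map
        (star u).toLinearMap) ?_
    intro x hx
    have hx' : Q x = 0 := hx
    refine ⟨u x, (hap x).trans ?_, huu _⟩
    rw [hx', map_zero]

theorem hasDerivAt_exp_conj (Y Q : H →L[ℂ] H) (hY : Y ∈ skewAdjoint (H →L[ℂ] H)) :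
    HasDerivAt (fun t : ℝ => NormedSpace.exp (t • Y) * Q * star (NormedSpace.exp (t • Y)))
      (Y * Q - Q * Y) 0 := by
  have h := hasDerivAt_exp_smul_const (𝕂 := ℝ) Y 0
  have hmul := (h.mul_const Q).mul h.star
  rw [zero_smul, NormedSpace.exp_zero, star_mul, star_one, skewAdjoint.mem_iff.1 hY, one_mul,
    mul_one, mul_one, one_mul, mul_neg, ← sub_eq_add_neg] at hmul
  exact hmul

/-- Every projection in `infProjections H` is the limit of projections `Q'` in `infProjections H`
for which `Q' P (1 - Q')` is not compact. -/
theorem exists_tendsto_frequently_not_isCompactOperator {P Q : H →L[ℂ] H}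
    (hP : P ∈ infProjections H) (hQ : Q ∈ infProjections H) :
    ∃ q : ℝ → H →L[ℂ] H, (∀ t, q t ∈ infProjections H) ∧ Tendsto q (𝓝 0) (𝓝 Q) ∧
      ∃ᶠ t in 𝓝 0, ¬ IsCompactOperator (q t * P * (1 - q t) : H →L[ℂ] H) := by
  by_cases hPQ : Q * P * (1 - Q) ∈ compactOperator (RingHom.id ℂ) H H
  · obtain ⟨Y, hY, hYK⟩ := exists_skewAdjoint_notMem_compactOperator hP hQ hPQ
    have hd := hasDerivAt_exp_conj Y Q hY
    let : NormedAlgebra ℚ (H →L[ℂ] H) := .restrictScalars ℚ ℂ (H →L[ℂ] H)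
    set q : ℝ → H →L[ℂ] H :=
      fun t => NormedSpace.exp (t • Y) * Q * star (NormedSpace.exp (t • Y)) with hq
    have hq0 : q 0 = Q := by simp [hq]
    refine ⟨q, fun t => conj_mem_infProjections hQ
      (NormedSpace.exp_mem_unitary_of_mem_skewAdjoint (skewAdjoint.smul_mem t hY)), ?_, ?_⟩
    · have := hd.continuousAt.tendsto
      rwa [hq0] at this
    · intro hev
      refine hYK ?_
      have hf := (hd.mul_const P).mul (hd.const_sub 1)
      have hslope := hf.tendsto_slope
      -- Compact difference quotients force a compact derivative, since norm limits of compact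
      -- operators are compact.
      have hK : ∀ᶠ t in 𝓝[≠] (0 : ℝ), IsCompactOperator
          (slope ((fun t => q t * P) * fun t => 1 - q t) 0 t : H →L[ℂ] H) := by
        filter_upwards [nhdsWithin_le_nhds hev] with t ht
        have ht' : q t * P * (1 - q t) ∈ compactOperator (RingHom.id ℂ) H H := not_not.1 ht
        have h0 : q 0 * P * (1 - q 0) ∈ compactOperator (RingHom.id ℂ) H H := by rwa [hq0]
        rw [slope_def_module]
        exact ((compactOperator (RingHom.id ℂ) H H).sub_mem ht' h0 : IsCompactOperator _).smul _
      have := isCompactOperator_of_tendsto hslope hK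
      rwa [hq0, mul_neg, ← sub_eq_add_neg] at this
  · exact ⟨fun _ => Q, fun _ => hQ, tendsto_const_nhds,
      (Eventually.of_forall fun _ => hPQ).frequently⟩

end Perturbation

/-- `Δ_∞` is dense in the space `P_{∞,∞} × P_{∞,∞}`, with the topology of the operator norm. -/
theorem mainTheorem3 (H : Type*) [NormedAddCommGroup H] [InnerProductSpace ℂ H]
    [CompleteSpace H] [TopologicalSpace.SeparableSpace H] :
    Dense {x : ↥(infProjections H ×ˢ infProjections H) |
      (x : (H →L[ℂ] H) × (H →L[ℂ] H)) ∈ commonComplementPairsInf H} := by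
  rintro ⟨⟨P, Q⟩, hP, hQ⟩
  obtain ⟨q, hq, hlim, hfreq⟩ := exists_tendsto_frequently_not_isCompactOperator hP hQ
  refine mem_closure_of_frequently_of_tendsto
    (f := fun t => (⟨(P, q t), hP, hq t⟩ : ↥(infProjections H ×ˢ infProjections H)))
    (hfreq.mono fun t ht => ?_) (tendsto_subtype_rng.2 (tendsto_const_nhds.prodMk_nhds hlim))
  exact ⟨⟨hP.1, (hq t).1, haveCommonComplement_of_not_isCompactOperator hP.1 (hq t).1 ht⟩,
    hP, hq t⟩
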